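/- \textbf{Setting.} Fix integers $n\ge k\ge 2$ and $r\ge 0$, labels $[k]$ and instances $\mathcal X=[k]^n$; on the instance $x\in\mathcal X$ expert $i\in\{1,\dots,n\}$ predicts $x_i$. A randomized learner with bandit feedback is a map which, given the past feedback (for each past round: the instance, the learner's prediction, and whether it was correct) and the current instance, returns a probability distribution over $[k]$ from which its prediction is drawn. \emph{Oblivious adversary.} The adversary fixes in advance a finite sequence $S=(x_1,y_1),\dots,(x_T,y_T)$ in $\mathcal X\times[k]$ such that some expert $i$ satisfies $\#\{t: (x_t)_i\ne y_t\}\le r$. In round $t$ the learner sees $x_t$, predicts $\hat y_t$, and is told only whether $\hat y_t=y_t$. Let $\mathsf{opt}^{\mathrm{obl}}_{\mathrm{bandit}}(n,k,r)$ be the infimum over learners of the supremum over such $S$ of the expected number of mistakes. \emph{Adaptive adversary.} In each round the adversary chooses $x_t$ as a function of the past feedback; the learner announces its distribution $\pi^{(t)}$; the adversary chooses a distribution $\tau^{(t)}$ over $[k]$ as a function of the past feedback, $x_t$ and $\pi^{(t)}$; then $\hat y_t\sim\pi^{(t)}$ and $y_t\sim\tau^{(t)}$ are drawn independently, and the learner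 is told only whether $\hat y_t=y_t$. A feedback sequence is called realizable if there are labels $y'_1,y'_2,\dots$, one per round, with ($\hat y_t=y'_t$ if and only if the feedback in round $t$ was positive), and an expert $i$ with $\#\{t:(x_t)_i\neq y'_t\}\le r$. The adversary is required to be consistent: for every realizable feedback sequence $F$ and every announced distribution $\pi$, if $x$ is the instance it chooses after $F$, then for every label $y$ in the support of the distribution it chooses, $F$ followed by ``on $x$ the prediction $y$ was correct'' is again realizable. Let $\mathsf{opt}^{\mathrm{adap}}_{\mathrm{bandit}}(n,k,r)$ be the infimum over learners of the supremum over consistent adaptive adversaries of the expected number of mistakes in the entire (unbounded) game. \textbf{Theorem.} (1) There are universal constants $c_1,c_2>0$ such that for all integers $n\ge k\ge 2$ and $r\ge 0$, \[ c_1\,k(\log_k n+r)\;\le\;\mathsf{opt}^{\mathrm{adap}}_{\mathrm{bandit}}(n,k,r)\;\le\; c_2\,k(\log_k n+r). \] (2) For every real $C$ there are constants $c_1,c_2>0$ depending only on $C$ such that for all integers $n\ge k\ge 2$ and $r\ge 0$ with $r\le C\log_k n$, \[ c_1\,k\log_k n\;\le\;\mathsf{opt}^{\mathrm{obl}}_{\mathrm{bandit}}(n,k,r)\;\le\;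 c_2\,k\log_k n. \] -/

import Mathlib

open scoped ENNReal

namespace BanditExperts

/-- A pattern: a finite sequence of labelled examples `(x, y)`. -/
abbrev Pattern (X Y : Type*) := List (X × Y)

/-- A bandit feedback sequence, in chronological order. The triplet `(x, true, y)` records that on the
instance `x` the prediction `y` was correct; `(x, false, y)` records that it was incorrect. -/
abbrev FeedbackSeq (X Y : Type*) := List (X × Bool × Y)

/-- A randomized learner with bandit feedback: from the past feedback and the current instance it
computes a probability distribution over the labels, from which its prediction is drawn. -/
abbrev Learner (X Y : Type*) := FeedbackSeq X Y → X → PMF Y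

/-- An adaptive adversary: `inst` chooses the instance from the past feedback; `label` chooses the
distribution of the correct label from the past feedback, the instance and the distribution
announced by the learner. -/
structure Adversary (X Y : Type*) where
  inst : FeedbackSeq X Y → X
  label : FeedbackSeq X Y → X → PMF Y → PMF Y

section Games

variable {X Y : Type*}

/-- The pattern `p` agrees with the feedback sequence `F`: same length, same instances, and in every
round the recorded prediction equals the label of `p` exactly when the feedback is positive. -/
def Agrees (p : Pattern X Y) (F : FeedbackSeq X Y) : Prop :=
  List.Forall₂ (fun e f => e.1 = f.1 ∧ (f.2.1 = true ↔ f.2.2 = e.2)) p F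

/-- `F` is realizable by the pattern class `P`. -/
def Realizable (P : Set (Pattern X Y)) (F : FeedbackSeq X Y) : Prop :=
  ∃ p ∈ P, Agrees p F

/-- The adaptive adversary `A` is consistent with the pattern class `P` (weak realizability). -/
def Adversary.Consistent (A : Adversary X Y) (P : Set (Pattern X Y)) : Prop :=
  ∀ F : FeedbackSeq X Y, Realizable P F → ∀ π : PMF Y,
    ∀ y ∈ (A.label F (A.inst F) π).support, Realizable P (F ++ [(A.inst F, true, y)])

variable [Fintype Y] [DecidableEq Y]

/-- Expected number of mistakes of `L` on the remaining fixed input sequence `S`, when the feedback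
given so far is `F`. -/
noncomputable def oblLossFrom (L : Learner X Y) : FeedbackSeq X Y → Pattern X Y → ℝ≥0∞
  | _, [] => 0
  | F, (x, y) :: S =>
      ∑ z : Y, L F x z *
        (if z = y then oblLossFrom L (F ++ [(x, true, z)]) S
          else 1 + oblLossFrom L (F ++ [(x, false, z)]) S)

/-- Expected number of mistakes of `L` on the fixed input sequence `S` with bandit feedback. -/
noncomputable def oblLoss (L : Learner X Y) (S : Pattern X Y) : ℝ≥0∞ := oblLossFrom L [] S

/-- Expected number of mistakes of `L` against `A` in the next `T` rounds, when the feedback given so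
far is `F`. In each round the prediction `z` and the correct label `y` are drawn independently from
the distributions chosen by `L` and by `A`. -/
noncomputable def adapLossFrom (L : Learner X Y) (A : Adversary X Y) :
    ℕ → FeedbackSeq X Y → ℝ≥0∞
  | 0, _ => 0
  | T + 1, F =>
      ∑ z : Y, ∑ y : Y,
        L F (A.inst F) z * A.label F (A.inst F) (L F (A.inst F)) y *
          (if z = y then adapLossFrom L A T (F ++ [(A.inst F, true, z)])
            else 1 + adapLossFrom L A T (F ++ [(A.inst F, false, z)]))

/-- Expected number of mistakes of `L` against `A` in the entire (unbounded) game: the supremum, which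
is also the limit, of the expected number of mistakes in the first `T` rounds. -/
noncomputable def adapLoss (L : Learner X Y) (A : Adversary X Y) : ℝ≥0∞ :=
  ⨆ T : ℕ, adapLossFrom L A T []

/-- Optimal mistake bound of the pattern class `P` with bandit feedback, oblivious adversary. -/
noncomputable def optObl (P : Set (Pattern X Y)) : ℝ≥0∞ :=
  ⨅ L : Learner X Y, ⨆ S ∈ P, oblLoss L S

/-- Optimal mistake bound of the pattern class `P` with bandit feedback, adaptive adversary. -/
noncomputable def optAdap (P : Set (Pattern X Y)) : ℝ≥0∞ :=
  ⨅ L : Learner X Y, ⨆ (A : Adversary X Y) (_ : A.Consistent P), adapLoss L A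

end Games

/-- Patterns that some `h ∈ H` fits with the exception of at most `B h` many places. -/
def budgetedPatterns {X Y : Type*} [DecidableEq Y] (H : Set (X → Y)) (B : (X → Y) → ℕ) :
    Set (Pattern X Y) :=
  {p | ∃ h ∈ H, p.countP (fun e => decide (h e.1 ≠ e.2)) ≤ B h}

/-- The class of `n` experts with `k` labels: an instance is the vector of all expert predictions, and
the `i`-th expert is the projection to the `i`-th entry. -/
def experts (n k : ℕ) : Set ((Fin n → Fin k) → Fin k) :=
  Set.range fun i x => x i

/-- `n` experts, `k` labels, and the best expert is inconsistent at most `r` times. -/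
def expertPatterns (n k r : ℕ) : Set (Pattern (Fin n → Fin k) (Fin k)) :=
  budgetedPatterns (experts n k) (fun _ => r)

/-- Optimal mistake bound for prediction with expert advice, bandit feedback, oblivious adversary. -/
noncomputable def optExpertsObl (n k r : ℕ) : ℝ≥0∞ := optObl (expertPatterns n k r)

/-- Optimal mistake bound for prediction with expert advice, bandit feedback, adaptive adversary. -/
noncomputable def optExpertsAdap (n k r : ℕ) : ℝ≥0∞ := optAdap (expertPatterns n k r)

end BanditExperts

/-!
Only the following enters about realizability: a feedback sequence is realizable exactly if some
expert is refuted by at most `r` of its rounds, where a round refutes an expert if another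
prediction was correct or if the expert's own prediction was incorrect
(`realizable_budgetedPatterns_iff`).

*Upper bound.* Every expert gets the weight `k⁻¹ ^ (number of refutations)`. If some label carries at
least a `1 / (4 √k)` fraction of the total weight, the learner predicts it: a mistake then shrinks the
total weight by a factor `1 - Ω(1 / √k)`. Otherwise it predicts uniformly at random: whatever the
correct label is, it is hit with probability `1 / k`, and then the total weight shrinks by a factor
`√k`, because little of it was on that label. In both cases `16 k log_k (total weight)` decreases in
expectation by at least the probability of a mistake (`weightLearner_step`). The total weight starts
at `n` and stays at least `k ^ (-r)` as long as the feedback is realizable, which gives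
`16 k (log_k n + r)` (`optAdap_le`). An adaptive adversary can simulate an oblivious one
(`optObl_le_optAdap`), so the bound holds for both.

*Lower bound in `n`.* Write the numbers of the experts in base `k`. For each of the `⌊log_k n⌋` lowest
digits the adversary repeats `k` times the instance on which each expert predicts this digit of its
own number, with a random secret digit as the correct label. Finding a secret label costs
`(k - 1) / 2` mistakes on average, and the secret digits are those of some expert, which makes no
mistake (`le_optExpertsObl`).

*Lower bound in `r`.* An adaptive adversary repeats one instance on which all `k` labels are predicted,
and declares the learner's least likely label `y` correct. Give every label a budget of `r`
refutations. A mistake takes one unit from the total budget `k r`, and a correct prediction takes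
`k - 1` units; but the latter has probability at most that of each other label, so that it costs in
expectation at most what the mistakes cost. Hence the expected number of mistakes is at least
`k r / 2` (`card_mul_le_two_mul_optAdap`).
-/

namespace BanditExperts

/-! ### Realizable feedback -/

section Realizability

variable {X Y : Type*}

lemma agrees_append {p : Pattern X Y} {F : FeedbackSeq X Y} (hpF : Agrees p F) {x : X} {b : Bool}
    {y z : Y} (h : b = true ↔ z = y) : Agrees (p ++ [(x, y)]) (F ++ [(x, b, z)]) := by
  unfold Agrees at *
  refine List.rel_append hpF ?_
  simp [h]

variable [DecidableEq Y]

/-- The number of rounds of `F` whose feedback refutes the prediction of `h`: it was correct to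
predict something else, or it was incorrect to predict the value of `h`. -/
def refutations (h : X → Y) (F : FeedbackSeq X Y) : ℕ :=
  F.countP fun f => decide (f.2.1 = true ↔ h f.1 ≠ f.2.2)

@[simp] lemma refutations_nil (h : X → Y) : refutations h [] = 0 := rfl

lemma refutations_append_true (h : X → Y) (F : FeedbackSeq X Y) (x : X) (y : Y) :
    refutations h (F ++ [(x, true, y)]) = refutations h F + if h x = y then 0 else 1 := by
  by_cases hy : h x = y <;> simp [refutations, hy]

lemma refutations_append_false (h : X → Y) (F : FeedbackSeq X Y) (x : X) (y : Y) :
    refutations h (F ++ [(x, false, y)]) = refutations h F + if h x = y then 1 else 0 := by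
  by_cases hy : h x = y <;> simp [refutations, hy]

lemma refutations_le_countP (h : X → Y) {p : Pattern X Y} {F : FeedbackSeq X Y}
    (hpF : Agrees p F) :
    refutations h F ≤ p.countP fun e => decide (h e.1 ≠ e.2) := by
  unfold Agrees at hpF
  induction hpF with
  | nil => simp
  | @cons e f p F hef _ ih =>
    obtain ⟨x, y⟩ := e
    obtain ⟨x', b, z⟩ := f
    obtain ⟨rfl, hb⟩ := hef
    simp only [refutations, List.countP_cons, decide_eq_true_eq] at *
    change b = true ↔ z = y at hb
    have : (b = true ↔ h x ≠ z) → h x ≠ y := by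
      rintro h1 h2
      rw [hb] at h1
      grind
    split_ifs <;> grind

/-- The labels that `h` itself gives, changed only where the feedback refutes `h`, form a pattern
agreeing with the feedback. -/
lemma exists_agrees_countP_eq [Nontrivial Y] (h : X → Y) (F : FeedbackSeq X Y) :
    ∃ p : Pattern X Y, Agrees p F ∧
      p.countP (fun e => decide (h e.1 ≠ e.2)) = refutations h F := by
  unfold Agrees
  induction F with
  | nil => exact ⟨[], .nil, rfl⟩
  | cons f F ih =>
    obtain ⟨p, hp, hc⟩ := ih
    obtain ⟨x, b, z⟩ := f
    have : ∃ y, (b = true ↔ z = y) ∧ (h x ≠ y ↔ (b = true ↔ h x ≠ z)) := by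
      cases b
      · by_cases hz : h x = z
        · obtain ⟨y, hy⟩ := exists_ne z
          exact ⟨y, by simp [hy.symm], by simp [hz, hy.symm]⟩
        · exact ⟨h x, by simp [Ne.symm hz], by simp [hz]⟩
      · exact ⟨z, by simp, by simp⟩
    obtain ⟨y, hy, hxy⟩ := this
    refine ⟨(x, y) :: p, .cons ⟨rfl, hy⟩ hp, ?_⟩
    simp only [refutations, List.countP_cons, decide_eq_true_eq] at *
    simp only [hc, hxy]

lemma realizable_budgetedPatterns_iff [Nontrivial Y] {H : Set (X → Y)} {B : (X → Y) → ℕ}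
    {F : FeedbackSeq X Y} :
    Realizable (budgetedPatterns H B) F ↔ ∃ h ∈ H, refutations h F ≤ B h := by
  constructor
  · rintro ⟨p, ⟨h, hH, hB⟩, hpF⟩
    exact ⟨h, hH, (refutations_le_countP h hpF).trans hB⟩
  · rintro ⟨h, hH, hB⟩
    obtain ⟨p, hpF, hc⟩ := exists_agrees_countP_eq h F
    exact ⟨p, ⟨h, hH, hc.trans_le hB⟩, hpF⟩

lemma Realizable.exists_append_true [Nontrivial Y] {H : Set (X → Y)} {B : (X → Y) → ℕ}
    {F : FeedbackSeq X Y} (hF : Realizable (budgetedPatterns H B) F) (x : X) :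
    ∃ y, Realizable (budgetedPatterns H B) (F ++ [(x, true, y)]) := by
  simp only [realizable_budgetedPatterns_iff] at *
  obtain ⟨h, hH, hB⟩ := hF
  exact ⟨h x, h, hH, by simpa [refutations_append_true] using hB⟩

/-- If `y` is an admissible correct label, then the negative feedback on any other prediction is
realizable as well. -/
lemma Realizable.append_false [Nontrivial Y] {H : Set (X → Y)} {B : (X → Y) → ℕ}
    {F : FeedbackSeq X Y} {x : X} {y z : Y}
    (hF : Realizable (budgetedPatterns H B) (F ++ [(x, true, y)])) (hzy : z ≠ y) :
    Realizable (budgetedPatterns H B) (F ++ [(x, false, z)]) := by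
  simp only [realizable_budgetedPatterns_iff] at *
  obtain ⟨h, hH, hB⟩ := hF
  refine ⟨h, hH, ?_⟩
  rw [refutations_append_true] at hB
  rw [refutations_append_false]
  split_ifs at * <;> grind

end Realizability

/-! ### Consistent adversaries; oblivious against adaptive -/

section GuardedAdversary

lemma sum_pmf_mul_const {Y : Type*} [Fintype Y] (π : PMF Y) (c : ℝ≥0∞) : ∑ y, π y * c = c := by
  rw [← Finset.sum_mul, ← tsum_fintype (L := .unconditional Y), PMF.tsum_coe, one_mul]

variable {X Y : Type*}

open Classical in
/-- The adversary that chooses instances by `inst` and the label `target` whenever this is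
consistent with `P`, and otherwise some label that is. When no label is, consistency asks for
nothing, and the learner's own distribution serves as a placeholder. -/
noncomputable def guardedAdversary (P : Set (Pattern X Y)) (inst : FeedbackSeq X Y → X)
    (target : FeedbackSeq X Y → PMF Y → Y) : Adversary X Y where
  inst := inst
  label F x π :=
    if Realizable P (F ++ [(x, true, target F π)]) then PMF.pure (target F π)
    else if h : ∃ y, Realizable P (F ++ [(x, true, y)]) then PMF.pure h.choose
    else π

lemma guardedAdversary_consistent [DecidableEq Y] [Nontrivial Y] (H : Set (X → Y))
    (B : (X → Y) → ℕ) (inst : FeedbackSeq X Y → X) (target : FeedbackSeq X Y → PMF Y → Y) :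
    (guardedAdversary (budgetedPatterns H B) inst target).Consistent (budgetedPatterns H B) := by
  intro F hF π y hy
  have hex := hF.exists_append_true (inst F)
  simp only [guardedAdversary] at hy ⊢
  split_ifs at hy with h1
  · simp only [PMF.support_pure, Set.mem_singleton_iff] at hy
    exact hy ▸ h1
  · simp only [PMF.support_pure, Set.mem_singleton_iff] at hy
    exact hy ▸ hex.choose_spec

lemma adapLossFrom_guardedAdversary_succ [Fintype Y] [DecidableEq Y] (P : Set (Pattern X Y))
    (inst : FeedbackSeq X Y → X) (target : FeedbackSeq X Y → PMF Y → Y) (L : Learner X Y) (T : ℕ)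
    (F : FeedbackSeq X Y) {y : Y} (hy : target F (L F (inst F)) = y)
    (h : Realizable P (F ++ [(inst F, true, y)])) :
    adapLossFrom L (guardedAdversary P inst target) (T + 1) F =
      ∑ z : Y, L F (inst F) z *
        (if z = y then adapLossFrom L (guardedAdversary P inst target) T (F ++ [(inst F, true, z)])
          else 1 + adapLossFrom L (guardedAdversary P inst target) T
            (F ++ [(inst F, false, z)])) := by
  subst hy
  have hl : (guardedAdversary P inst target).label F (inst F) (L F (inst F)) =
      PMF.pure (target F (L F (inst F))) := by
    simp only [guardedAdversary, if_pos h]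
  have hi : (guardedAdversary P inst target).inst F = inst F := rfl
  rw [adapLossFrom, hi, hl]
  refine Finset.sum_congr rfl fun z _ => ?_
  rw [Finset.sum_eq_single (target F (L F (inst F)))]
  · simp
  · intro y _ hy
    simp [PMF.pure_apply, hy]
  · simp

lemma mem_budgetedPatterns_of_prefix [DecidableEq Y] {H : Set (X → Y)} {B : (X → Y) → ℕ}
    {p q : Pattern X Y} (hq : q ∈ budgetedPatterns H B) (hpq : p <+: q) :
    p ∈ budgetedPatterns H B := by
  obtain ⟨h, hH, hB⟩ := hq
  exact ⟨h, hH, (hpq.sublist.countP_le).trans hB⟩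

/-- An adaptive adversary can follow a sequence fixed in advance. Consistency has to hold also after
feedback that contradicts the sequence, and for this the adversary is guarded. -/
theorem optObl_le_optAdap [Fintype Y] [DecidableEq Y] [Nontrivial Y] (H : Set (X → Y))
    (B : (X → Y) → ℕ) : optObl (budgetedPatterns H B) ≤ optAdap (budgetedPatterns H B) := by
  refine iInf_mono fun L => iSup₂_le fun S hS => ?_
  rcases S with _ | ⟨e, S₀⟩
  · simp [oblLoss, oblLossFrom]
  set S := e :: S₀
  -- The fallback `e` is only reached after the end of `S`.
  set A := guardedAdversary (budgetedPatterns H B) (fun F => (S.getD F.length e).1)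
    (fun F _ => (S.getD F.length e).2) with hA
  have key : ∀ (S₂ S₁ : Pattern X Y) (F : FeedbackSeq X Y), S₁ ++ S₂ = S → Agrees S₁ F →
      oblLossFrom L F S₂ ≤ adapLossFrom L A S₂.length F := by
    intro S₂
    induction S₂ with
    | nil => intro S₁ F _ _; simp [oblLossFrom]
    | cons a S₂ ih =>
      intro S₁ F hS₁ hF
      obtain ⟨x, y⟩ := a
      have hlen : F.length = S₁.length := (List.Forall₂.length_eq hF).symm
      have hget : S.getD F.length e = (x, y) := by
        rw [← hS₁, hlen]; simp
      have hpre : S₁ ++ [(x, y)] ++ S₂ = S := by simpa using hS₁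
      have hT : Agrees (S₁ ++ [(x, y)]) (F ++ [(x, true, y)]) := agrees_append hF (by simp)
      have hinst : (S.getD F.length e).1 = x := by rw [hget]
      have hreal : Realizable (budgetedPatterns H B) (F ++ [((S.getD F.length e).1, true, y)]) := by
        rw [hinst]
        exact ⟨_, mem_budgetedPatterns_of_prefix hS ⟨S₂, hpre⟩, hT⟩
      rw [List.length_cons, hA, adapLossFrom_guardedAdversary_succ (y := y) _ _ _ _ _ _
        (by rw [hget]) hreal, ← hA, oblLossFrom]
      simp only [hinst]
      refine Finset.sum_le_sum fun z _ => mul_le_mul_right ?_ _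
      split_ifs with hz
      · exact ih _ _ hpre (agrees_append hF (by simp [hz]))
      · exact add_le_add_right (ih _ _ hpre (agrees_append hF (by simp [hz]))) _
  refine (key S [] [] rfl .nil).trans ?_
  exact (le_iSup (fun T => adapLossFrom L A T []) _).trans
    (le_iSup₂ (f := fun (A : Adversary X Y) (_ : A.Consistent (budgetedPatterns H B)) =>
      adapLoss L A) A (guardedAdversary_consistent _ _ _ _))

end GuardedAdversary

/-! ### Lower bound against an oblivious adversary -/

section ObliviousLowerBound

variable {X Y : Type*} [Fintype Y] [DecidableEq Y]

/-- Searching for a secret label among the candidates `A`, all rounds with the same instance: in each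
round the learner can discard one candidate only, whence the binomial coefficient. The search is
followed by one of the patterns `cont i`, whose total loss is at least `b` whatever happened
before. -/
lemma le_sum_oblLossFrom_replicate_append (L : Learner X Y) (x : X) {ι : Type*} [Fintype ι]
    (cont : ι → Pattern X Y) (b : ℝ≥0∞) (hb : ∀ F, b ≤ ∑ i, oblLossFrom L F (cont i)) (R : ℕ)
    (A : Finset Y) (F : FeedbackSeq X Y) (hA : A.card ≤ R + 1) :
    A.card * b + Fintype.card ι * (A.card.choose 2 : ℕ) ≤
      ∑ y ∈ A, ∑ i, oblLossFrom L F (List.replicate R (x, y) ++ cont i) := by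
  induction R generalizing A F with
  | zero =>
    rw [Nat.choose_eq_zero_of_lt (by omega)]
    simpa using Finset.card_nsmul_le_sum A (fun y => ∑ i, oblLossFrom L F (cont i)) b
      fun _ _ => hb F
  | succ R ih =>
    rcases A.eq_empty_or_nonempty with rfl | hne
    · simp
    have hswap : ∑ y ∈ A, ∑ i, oblLossFrom L F (List.replicate (R + 1) (x, y) ++ cont i) =
        ∑ z, L F x z * ∑ y ∈ A, ∑ i,
          (if z = y then oblLossFrom L (F ++ [(x, true, z)]) (List.replicate R (x, y) ++ cont i)
            else 1 +
              oblLossFrom L (F ++ [(x, false, z)]) (List.replicate R (x, y) ++ cont i)) := by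
      simp only [List.replicate_succ, List.cons_append, oblLossFrom, Finset.mul_sum]
      rw [Finset.sum_comm (s := Finset.univ) (t := A)]
      exact Finset.sum_congr rfl fun y _ => Finset.sum_comm
    rw [hswap]
    refine (sum_pmf_mul_const (L F x) _).ge.trans ?_
    refine Finset.sum_le_sum fun z _ => mul_le_mul_right ?_ _
    -- The candidate discarded in this round is `z`, if it was still there.
    obtain ⟨a, haA, haz⟩ : ∃ a ∈ A, z ∈ A → a = z := by
      by_cases hz : z ∈ A
      · exact ⟨z, hz, fun _ => rfl⟩
      · exact ⟨hne.choose, hne.choose_spec, fun h => absurd h hz⟩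
    have hcard : A.card = (A.erase a).card + 1 := (Finset.card_erase_add_one haA).symm
    have ha : b ≤ ∑ i, (if z = a then
        oblLossFrom L (F ++ [(x, true, z)]) (List.replicate R (x, a) ++ cont i)
          else 1 + oblLossFrom L (F ++ [(x, false, z)]) (List.replicate R (x, a) ++ cont i)) := by
      split_ifs
      · simpa using ih {a} (F ++ [(x, true, z)]) (by simp)
      · refine le_trans (by simpa using ih {a} (F ++ [(x, false, z)]) (by simp))
          (Finset.sum_le_sum fun i _ => le_add_self)
    have hrest := ih (A.erase a) (F ++ [(x, false, z)]) (by omega)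
    rw [← Finset.add_sum_erase _ _ haA]
    have heq : ∑ y ∈ A.erase a, ∑ i, (if z = y then
        oblLossFrom L (F ++ [(x, true, z)]) (List.replicate R (x, y) ++ cont i)
          else 1 + oblLossFrom L (F ++ [(x, false, z)]) (List.replicate R (x, y) ++ cont i)) =
        (A.erase a).card * Fintype.card ι + ∑ y ∈ A.erase a, ∑ i,
          oblLossFrom L (F ++ [(x, false, z)]) (List.replicate R (x, y) ++ cont i) := by
      have : ∀ y ∈ A.erase a, z ≠ y := by
        rintro y hy rfl
        rw [Finset.mem_erase] at hy
        exact hy.1 (haz hy.2).symm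
      rw [Finset.sum_congr rfl fun y hy => Finset.sum_congr rfl fun i _ => if_neg (this y hy)]
      simp [Finset.sum_add_distrib]
    rw [heq, hcard, Nat.choose_succ_succ' _ 1, Nat.choose_one_right]
    refine le_trans (le_of_eq ?_) (add_le_add ha (add_le_add_right hrest _))
    push_cast
    ring

/-- For each `j` in turn, the example `(x j, s j)`, repeated once per label. -/
def blockPattern {m : ℕ} (x : Fin m → X) (s : Fin m → Y) : Pattern X Y :=
  (List.ofFn fun j => List.replicate (Fintype.card Y) (x j, s j)).flatten

lemma le_sum_oblLossFrom_blockPattern (L : Learner X Y) {m : ℕ} (x : Fin m → X)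
    (F : FeedbackSeq X Y) :
    ((m * Fintype.card Y ^ (m - 1) * (Fintype.card Y).choose 2 : ℕ) : ℝ≥0∞) ≤
      ∑ s : Fin m → Y, oblLossFrom L F (blockPattern x s) := by
  induction m generalizing F with
  | zero => simp
  | succ m ih =>
    rw [← (Fin.consEquiv fun _ => Y).sum_comp, Fintype.sum_prod_type]
    have h := le_sum_oblLossFrom_replicate_append L (x 0)
      (fun s : Fin m → Y => blockPattern (fun j => x j.succ) s) _ (fun F => ih _ F)
      (Fintype.card Y) Finset.univ F (by simp)
    refine le_trans (le_of_eq ?_) (h.trans (le_of_eq ?_))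
    · norm_cast
      rw [Finset.card_univ, Fintype.card_fun, Fintype.card_fin]
      rcases m with _ | m
      · simp
      · simp only [Nat.add_sub_cancel]
        ring
    · refine Finset.sum_congr rfl fun y _ => Finset.sum_congr rfl fun s _ => ?_
      simp [blockPattern, List.ofFn_succ, Fin.consEquiv]

lemma le_two_mul_of_oblLoss_blockPattern_le [Nonempty Y] (L : Learner X Y) {m : ℕ}
    (x : Fin m → X) {M : ℝ≥0∞} (hM : ∀ s : Fin m → Y, oblLoss L (blockPattern x s) ≤ M) :
    ((m * (Fintype.card Y - 1) : ℕ) : ℝ≥0∞) ≤ 2 * M := by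
  have h := (le_sum_oblLossFrom_blockPattern L x []).trans
    (Finset.sum_le_card_nsmul _ _ M fun s _ => hM s)
  rw [Finset.card_univ, Fintype.card_fun, Fintype.card_fin, nsmul_eq_mul] at h
  set K := Fintype.card Y with hKdef
  have hK : 0 < K := Fintype.card_pos
  have hK0 : ((K ^ m : ℕ) : ℝ≥0∞) ≠ 0 := by
    exact_mod_cast (pow_pos hK m).ne'
  rw [← ENNReal.mul_le_mul_iff_right hK0 (ENNReal.natCast_ne_top _)]
  calc ((K ^ m : ℕ) : ℝ≥0∞) * ((m * (K - 1) : ℕ) : ℝ≥0∞)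
      = 2 * ((m * K ^ (m - 1) * K.choose 2 : ℕ) : ℝ≥0∞) := by
        rw [← Nat.cast_mul, ← Nat.cast_ofNat (R := ℝ≥0∞) (n := 2), ← Nat.cast_mul]
        congr 1
        rcases m with _ | m
        · simp
        · have : K.choose 2 * 2 = K * (K - 1) := by
            rw [Nat.choose_two_right, Nat.div_mul_cancel (Nat.even_mul_pred_self K).two_dvd]
          rw [Nat.add_sub_cancel, pow_succ]
          calc K ^ m * K * ((m + 1) * (K - 1)) = (m + 1) * K ^ m * (K * (K - 1)) := by ring
            _ = _ := by rw [← this]; ring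
    _ ≤ 2 * ((K ^ m : ℕ) * M) := mul_le_mul_right h 2
    _ = _ := by ring

/-- For `n ≥ k ^ m` the experts predict, on suitable instances, the `m` lowest digits of their own
number in base `k`, and every combination of digits occurs. -/
lemma exists_blockPattern_mem_expertPatterns {n k m : ℕ} (hk : 0 < k) (hn : k ^ m ≤ n) (r : ℕ) :
    ∃ x : Fin m → Fin n → Fin k, ∀ s, blockPattern x s ∈ expertPatterns n k r := by
  refine ⟨fun j i => if h : i.1 < k ^ m then finFunctionFinEquiv.symm ⟨i, h⟩ j else ⟨0, hk⟩,
    fun s => ⟨_, ⟨Fin.castLE hn (finFunctionFinEquiv s), rfl⟩, ?_⟩⟩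
  refine (List.countP_eq_zero.2 ?_).trans_le r.zero_le
  intro e he
  simp only [blockPattern, List.mem_flatten, List.mem_ofFn] at he
  obtain ⟨_, ⟨j, rfl⟩, he⟩ := he
  rw [List.eq_of_mem_replicate he]
  have hlt := (finFunctionFinEquiv s).isLt
  simp only [ne_eq, decide_not, Bool.not_eq_true', decide_eq_false_iff_not, not_not,
    Fin.val_castLE, dif_pos hlt, Fin.eta, Equiv.symm_apply_apply]

lemma le_optExpertsObl {n k : ℕ} (hk : 2 ≤ k) (hn : k ≤ n) (r : ℕ) :
    ENNReal.ofReal (1 / 8 * (k * Real.logb k n)) ≤ optExpertsObl n k r := by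
  have : Nonempty (Fin k) := ⟨⟨0, by omega⟩⟩
  refine le_iInf fun L => ?_
  set M := ⨆ S ∈ expertPatterns n k r, oblLoss L S
  have hm1 : 1 ≤ Nat.log k n := Nat.log_pos (by omega) hn
  obtain ⟨x, hx⟩ := exists_blockPattern_mem_expertPatterns (by omega)
    (Nat.pow_log_le_self k (by omega : n ≠ 0)) r
  have h := le_two_mul_of_oblLoss_blockPattern_le L x (M := M)
    fun s => le_iSup₂ (f := fun S (_ : S ∈ expertPatterns n k r) => oblLoss L S) _ (hx s)
  rw [Fintype.card_fin] at h
  set m := Nat.log k n with hm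
  -- Rounding down loses at most a factor of two, because `m ≥ 1`.
  have hlog : Real.logb k n ≤ m + 1 := by
    rw [Real.logb_le_iff_le_rpow (by exact_mod_cast hk) (by exact_mod_cast (by omega : 0 < n))]
    exact_mod_cast (Nat.lt_pow_succ_log_self (by omega : 1 < k) n).le
  have hm1' : (1 : ℝ) ≤ m := by exact_mod_cast hm1
  have hk' : (2 : ℝ) ≤ k := by exact_mod_cast hk
  have hreal : 1 / 8 * (k * Real.logb k n) ≤ ((m * (k - 1) : ℕ) : ℝ) / 2 := by
    rw [Nat.cast_mul, Nat.cast_sub (by omega)]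
    have : k * Real.logb k n ≤ (2 * (k - 1)) * (2 * m) :=
      mul_le_mul (by linarith) (by linarith)
        (Real.logb_nonneg (by linarith) (by exact_mod_cast (by omega : 1 ≤ n))) (by linarith)
    push_cast
    linarith
  refine (ENNReal.ofReal_le_ofReal hreal).trans ?_
  rw [ENNReal.ofReal_div_of_pos two_pos, ENNReal.ofReal_natCast, ENNReal.ofReal_ofNat]
  exact ENNReal.div_le_of_le_mul' h

end ObliviousLowerBound

/-! ### Lower bound against an adaptive adversary -/

section AdaptiveLowerBound

variable {X Y : Type*}

lemma refutations_eq_of_forall_eq [DecidableEq Y] {h : X → Y} {x₀ : X} {F : FeedbackSeq X Y}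
    (hF : ∀ f ∈ F, f.1 = x₀) : refutations h F = refutations (fun _ => h x₀) F := by
  refine List.countP_congr fun f hf => ?_
  rw [hF f hf]

/-- The label to which a distribution gives the least probability. -/
noncomputable def leastLikely [Fintype Y] [Nonempty Y] (π : PMF Y) : Y :=
  (Finite.exists_min π).choose

lemma leastLikely_le [Fintype Y] [Nonempty Y] (π : PMF Y) (z : Y) : π (leastLikely π) ≤ π z :=
  (Finite.exists_min π).choose_spec z

variable [Fintype Y] [DecidableEq Y]

/-- If all `|Y|` labels are possible on a single instance `x₀`, each with a budget of `r`, then this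
is how much of the total budget of the labels is left after `F`; the truncated subtraction makes it
zero once the budget is overspent. -/
def remainingBudget (r : ℕ) (F : FeedbackSeq X Y) : ℕ :=
  Fintype.card Y * r - ∑ y : Y, refutations (fun _ => y) F

lemma remainingBudget_append_true (r : ℕ) (F : FeedbackSeq X Y) (x : X) (z : Y) :
    remainingBudget r (F ++ [(x, true, z)]) = remainingBudget r F - (Fintype.card Y - 1) := by
  have : ∑ y : Y, (if y = z then 0 else 1) = Fintype.card Y - 1 := by
    rw [Finset.sum_ite, Finset.sum_const_zero, zero_add, Finset.sum_const, smul_eq_mul, mul_one,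
      Finset.filter_ne', Finset.card_erase_of_mem (Finset.mem_univ z), Finset.card_univ]
  simp only [remainingBudget, refutations_append_true, Finset.sum_add_distrib, this]
  omega

lemma remainingBudget_append_false (r : ℕ) (F : FeedbackSeq X Y) (x : X) (z : Y) :
    remainingBudget r (F ++ [(x, false, z)]) = remainingBudget r F - 1 := by
  simp only [remainingBudget, refutations_append_false, Finset.sum_add_distrib,
    Finset.sum_ite_eq', Finset.mem_univ, if_true]
  omega

/-- While budget remains, some label has not used up its own, so every label may be declared correct
once more. -/
lemma realizable_append_true_of_remainingBudget_pos [Nontrivial Y] {H : Set (X → Y)} {x₀ : X}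
    (hH : ∀ y, ∃ h ∈ H, h x₀ = y) {r : ℕ} {F : FeedbackSeq X Y} (hF : ∀ f ∈ F, f.1 = x₀)
    (hpos : 0 < remainingBudget r F) (y : Y) :
    Realizable (budgetedPatterns H fun _ => r) (F ++ [(x₀, true, y)]) := by
  obtain ⟨a, ha⟩ : ∃ a : Y, refutations (fun _ => a) F < r := by
    by_contra! hcon
    have := Finset.card_nsmul_le_sum Finset.univ (fun a : Y => refutations (fun _ => a) F) r
      fun a _ => hcon a
    rw [Finset.card_univ, smul_eq_mul] at this
    unfold remainingBudget at hpos
    omega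
  obtain ⟨h, hhH, rfl⟩ := hH a
  rw [realizable_budgetedPatterns_iff]
  refine ⟨h, hhH, ?_⟩
  rw [refutations_append_true, refutations_eq_of_forall_eq hF]
  split_ifs <;> omega

/-- Being correct on the least likely label costs `|Y| - 1` units of budget, but this is no more in
expectation than the single unit paid for each mistake. -/
lemma card_sub_one_mul_leastLikely_le [Nonempty Y] (π : PMF Y) :
    π (leastLikely π) * ((Fintype.card Y - 1 : ℕ) : ℝ≥0∞) ≤
      ∑ z, π z * (if z = leastLikely π then 0 else 1) := by
  have : ∑ z, π z * (if z = leastLikely π then 0 else 1) =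
      ∑ z ∈ Finset.univ.erase (leastLikely π), π z := by
    rw [← Finset.add_sum_erase _ _ (Finset.mem_univ (leastLikely π))]
    simp only [if_true, mul_zero, zero_add]
    exact Finset.sum_congr rfl fun z hz => by rw [if_neg (Finset.ne_of_mem_erase hz), mul_one]
  rw [this]
  have h := Finset.card_nsmul_le_sum (Finset.univ.erase (leastLikely π)) (fun z => π z) _
    fun z _ => leastLikely_le π z
  rwa [Finset.card_erase_of_mem (Finset.mem_univ _), Finset.card_univ, nsmul_eq_mul,
    mul_comm] at h

lemma remainingBudget_le_two_mul_adapLossFrom [Nontrivial Y] {H : Set (X → Y)} {x₀ : X}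
    (hH : ∀ y, ∃ h ∈ H, h x₀ = y) (r : ℕ) (L : Learner X Y) (T : ℕ) (F : FeedbackSeq X Y)
    (hF : ∀ f ∈ F, f.1 = x₀) (hT : remainingBudget r F ≤ T) :
    (remainingBudget r F : ℝ≥0∞) ≤ 2 * adapLossFrom L
      (guardedAdversary (budgetedPatterns H fun _ => r) (fun _ => x₀) fun _ => leastLikely) T F := by
  induction T generalizing F with
  | zero => simp [Nat.le_zero.1 hT]
  | succ T ih =>
    rcases Nat.eq_zero_or_pos (remainingBudget r F) with h0 | hpos
    · simp [h0]
    rw [adapLossFrom_guardedAdversary_succ (y := leastLikely (L F x₀)) _ _ _ _ _ _ rfl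
      (realizable_append_true_of_remainingBudget_pos hH hF hpos _)]
    set A := guardedAdversary (budgetedPatterns H fun _ => r) (fun _ => x₀) fun _ => leastLikely
    set π := L F x₀ with hπ
    set y := leastLikely π
    have hF' : ∀ b z, ∀ f ∈ F ++ [(x₀, b, z)], f.1 = x₀ := by
      intro b z f hf
      rcases List.mem_append.1 hf with hf | hf
      · exact hF f hf
      · rw [List.mem_singleton.1 hf]
    have hK : 1 < Fintype.card Y := Fintype.one_lt_card
    have hstep : ∀ z, (remainingBudget r F : ℝ≥0∞) ≤
        (if z = y then (remainingBudget r (F ++ [(x₀, true, z)]) : ℝ≥0∞)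
          else 1 + remainingBudget r (F ++ [(x₀, false, z)])) +
        (if z = y then ((Fintype.card Y - 1 : ℕ) : ℝ≥0∞) else 0) := by
      intro z
      rw [remainingBudget_append_true, remainingBudget_append_false]
      split_ifs
      · norm_cast; omega
      · norm_cast; omega
    calc (remainingBudget r F : ℝ≥0∞) = ∑ z, π z * remainingBudget r F :=
          (sum_pmf_mul_const π _).symm
      _ ≤ ∑ z, π z * ((if z = y then (remainingBudget r (F ++ [(x₀, true, z)]) : ℝ≥0∞)
            else 1 + remainingBudget r (F ++ [(x₀, false, z)])) +
          (if z = y then ((Fintype.card Y - 1 : ℕ) : ℝ≥0∞) else 0)) :=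
          Finset.sum_le_sum fun z _ => mul_le_mul_right (hstep z) _
      _ = ∑ z, π z * (if z = y then (remainingBudget r (F ++ [(x₀, true, z)]) : ℝ≥0∞)
            else 1 + remainingBudget r (F ++ [(x₀, false, z)])) +
          π y * ((Fintype.card Y - 1 : ℕ) : ℝ≥0∞) := by
          simp only [mul_add, Finset.sum_add_distrib, mul_ite, mul_zero, Finset.sum_ite_eq',
            Finset.mem_univ, if_true]
      _ ≤ ∑ z, π z * (if z = y then (remainingBudget r (F ++ [(x₀, true, z)]) : ℝ≥0∞)
            else 1 + remainingBudget r (F ++ [(x₀, false, z)])) +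
          ∑ z, π z * (if z = y then 0 else 1) :=
          add_le_add_right (card_sub_one_mul_leastLikely_le π) _
      _ = ∑ z, π z * ((if z = y then (remainingBudget r (F ++ [(x₀, true, z)]) : ℝ≥0∞)
            else 1 + remainingBudget r (F ++ [(x₀, false, z)])) + (if z = y then 0 else 1)) := by
          simp only [mul_add, Finset.sum_add_distrib]
      _ ≤ ∑ z, π z * (2 * (if z = y then adapLossFrom L A T (F ++ [(x₀, true, z)])
            else 1 + adapLossFrom L A T (F ++ [(x₀, false, z)]))) := by
          refine Finset.sum_le_sum fun z _ => mul_le_mul_right ?_ _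
          split_ifs
          · rw [add_zero]
            exact ih _ (hF' _ _) (by rw [remainingBudget_append_true]; omega)
          · have := ih _ (hF' false z) (by rw [remainingBudget_append_false]; omega)
            calc _ = 2 + (remainingBudget r (F ++ [(x₀, false, z)]) : ℝ≥0∞) := by ring
              _ ≤ 2 + 2 * adapLossFrom L A T (F ++ [(x₀, false, z)]) := add_le_add_right this _
              _ = _ := by ring
      _ = _ := by
          rw [Finset.mul_sum]
          exact Finset.sum_congr rfl fun z _ => by ring

lemma card_mul_le_two_mul_optAdap [Nontrivial Y] {H : Set (X → Y)} {x₀ : X}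
    (hH : ∀ y, ∃ h ∈ H, h x₀ = y) (r : ℕ) :
    ((Fintype.card Y * r : ℕ) : ℝ≥0∞) ≤ 2 * optAdap (budgetedPatterns H fun _ => r) := by
  rw [optAdap, ENNReal.mul_iInf_of_ne two_ne_zero ENNReal.ofNat_ne_top]
  refine le_iInf fun L => ?_
  have h := remainingBudget_le_two_mul_adapLossFrom hH r L _ [] (by simp) le_rfl
  rw [show remainingBudget r ([] : FeedbackSeq X Y) = Fintype.card Y * r by
    simp [remainingBudget]] at h
  refine h.trans (mul_le_mul_right ?_ _)
  exact (le_iSup (fun T => adapLossFrom L _ T []) _).trans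
    (le_iSup₂ (f := fun (A : Adversary X Y)
      (_ : A.Consistent (budgetedPatterns H fun _ => r)) => adapLoss L A) _
      (guardedAdversary_consistent _ _ _ _))

end AdaptiveLowerBound

/-! ### Upper bound by multiplicative weights -/

section UpperBound

lemma two_le_card {Y : Type*} [Fintype Y] [Nontrivial Y] : (2 : ℝ) ≤ Fintype.card Y := by
  exact_mod_cast Fintype.one_lt_card (α := Y)

lemma log_le_two_mul_sqrt {K : ℝ} (hK : 0 < K) : Real.log K ≤ 2 * √K := by
  have h1 : Real.log (√K) = Real.log K / 2 := Real.log_sqrt hK.le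
  have h2 := Real.log_le_sub_one_of_pos (Real.sqrt_pos.2 hK)
  linarith

variable {X Y ι : Type*} [Fintype Y] [DecidableEq Y] (h : ι → X → Y)

/-- The weight of the hypothesis `i`: each refutation divides it by the number of labels. -/
noncomputable def weight (F : FeedbackSeq X Y) (i : ι) : ℝ :=
  ((Fintype.card Y : ℝ)⁻¹) ^ refutations (h i) F

lemma weight_pos [Nontrivial Y] (F : FeedbackSeq X Y) (i : ι) : 0 < weight h F i := by
  have := two_le_card (Y := Y)
  unfold weight
  positivity

variable [Fintype ι]

/-- The total weight of all hypotheses. -/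
noncomputable def totalWeight (F : FeedbackSeq X Y) : ℝ := ∑ i, weight h F i

/-- The total weight of the hypotheses that predict `y` on `x`. -/
noncomputable def labelWeight (F : FeedbackSeq X Y) (x : X) (y : Y) : ℝ :=
  ∑ i, if h i x = y then weight h F i else 0

lemma totalWeight_append_true (F : FeedbackSeq X Y) (x : X) (y : Y) :
    totalWeight h (F ++ [(x, true, y)]) = labelWeight h F x y +
      (totalWeight h F - labelWeight h F x y) * (Fintype.card Y : ℝ)⁻¹ := by
  simp only [totalWeight, labelWeight, ← Finset.sum_sub_distrib, Finset.sum_mul,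
    ← Finset.sum_add_distrib]
  refine Finset.sum_congr rfl fun i _ => ?_
  simp only [weight, refutations_append_true]
  split_ifs <;> simp [pow_succ]

lemma totalWeight_append_false (F : FeedbackSeq X Y) (x : X) (z : Y) :
    totalWeight h (F ++ [(x, false, z)]) = totalWeight h F -
      labelWeight h F x z * (1 - (Fintype.card Y : ℝ)⁻¹) := by
  simp only [totalWeight, labelWeight, Finset.sum_mul, ← Finset.sum_sub_distrib]
  refine Finset.sum_congr rfl fun i _ => ?_
  simp only [weight, refutations_append_false]
  split_ifs
  · rw [pow_succ]; ring
  · simp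

variable [Nontrivial Y]

lemma labelWeight_nonneg (F : FeedbackSeq X Y) (x : X) (y : Y) : 0 ≤ labelWeight h F x y :=
  Finset.sum_nonneg fun i _ => by split_ifs <;> simp [(weight_pos h F i).le]

lemma labelWeight_le_totalWeight (F : FeedbackSeq X Y) (x : X) (y : Y) :
    labelWeight h F x y ≤ totalWeight h F :=
  Finset.sum_le_sum fun i _ => by split_ifs <;> simp [(weight_pos h F i).le]

lemma totalWeight_pos [Nonempty ι] (F : FeedbackSeq X Y) : 0 < totalWeight h F :=
  Finset.sum_pos (fun i _ => weight_pos h F i) Finset.univ_nonempty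

/-- The bound on the expected number of mistakes after `F`: up to a factor, the logarithm of the
total weight, normalized to be nonnegative as long as some hypothesis is refuted at most `r`
times. The factor `16` is what a mistake on a label of weight `1 / (4 √|Y|)` of the total requires. -/
noncomputable def potential (r : ℕ) (F : FeedbackSeq X Y) : ℝ :=
  16 * (Fintype.card Y * (Real.logb (Fintype.card Y) (totalWeight h F) + r))

lemma potential_mono {r : ℕ} {F F' : FeedbackSeq X Y} (hpos : 0 < totalWeight h F')
    (hle : totalWeight h F' ≤ totalWeight h F) : potential h r F' ≤ potential h r F := by
  have hK := two_le_card (Y := Y)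
  have := Real.logb_le_logb_of_le (by linarith : (1 : ℝ) < Fintype.card Y) hpos hle
  unfold potential
  gcongr

lemma potential_nonneg {r : ℕ} {F : FeedbackSeq X Y}
    (hF : Realizable (budgetedPatterns (Set.range h) fun _ => r) F) : 0 ≤ potential h r F := by
  have hK := two_le_card (Y := Y)
  obtain ⟨_, ⟨i, rfl⟩, hi⟩ := realizable_budgetedPatterns_iff.1 hF
  have hle : (Fintype.card Y : ℝ) ^ (-r : ℝ) ≤ totalWeight h F := by
    calc (Fintype.card Y : ℝ) ^ (-r : ℝ) = ((Fintype.card Y : ℝ)⁻¹) ^ r := by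
          rw [Real.rpow_neg (by linarith), Real.rpow_natCast, inv_pow]
      _ ≤ weight h F i :=
          pow_le_pow_of_le_one (by positivity) (inv_le_one_of_one_le₀ (by linarith)) hi
      _ ≤ totalWeight h F :=
          Finset.single_le_sum (fun i _ => (weight_pos h F i).le) (Finset.mem_univ i)
  have : (-r : ℝ) ≤ Real.logb (Fintype.card Y) (totalWeight h F) := by
    have : Nonempty ι := ⟨i⟩
    rwa [Real.le_logb_iff_rpow_le (by linarith) (totalWeight_pos h F)]
  unfold potential
  have : 0 ≤ Real.logb (Fintype.card Y) (totalWeight h F) + r := by linarith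
  positivity

lemma potential_append_true_le [Nonempty ι] (r : ℕ) (F : FeedbackSeq X Y) (x : X) (y : Y) :
    potential h r (F ++ [(x, true, y)]) ≤ potential h r F := by
  have hK := two_le_card (Y := Y)
  refine potential_mono h (totalWeight_pos h _) ?_
  rw [totalWeight_append_true]
  have h1 := labelWeight_le_totalWeight h F x y
  have h2 : (Fintype.card Y : ℝ)⁻¹ ≤ 1 := inv_le_one_of_one_le₀ (by linarith)
  nlinarith [mul_nonneg (sub_nonneg.2 h1) (sub_nonneg.2 h2)]

lemma potential_append_false_le [Nonempty ι] (r : ℕ) (F : FeedbackSeq X Y) (x : X) (z : Y) :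
    potential h r (F ++ [(x, false, z)]) ≤ potential h r F := by
  have hK := two_le_card (Y := Y)
  refine potential_mono h (totalWeight_pos h _) ?_
  rw [totalWeight_append_false]
  have h1 := labelWeight_nonneg h F x z
  have h2 : (Fintype.card Y : ℝ)⁻¹ ≤ 1 := inv_le_one_of_one_le₀ (by linarith)
  nlinarith [mul_nonneg h1 (sub_nonneg.2 h2)]

/-- A mistake on a label of large weight is paid for by the decrease of the potential. -/
lemma potential_append_false_add_one_le [Nonempty ι] (r : ℕ) (F : FeedbackSeq X Y) (x : X) (z : Y)
    (hz : totalWeight h F ≤ 4 * √(Fintype.card Y) * labelWeight h F x z) :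
    potential h r (F ++ [(x, false, z)]) + 1 ≤ potential h r F := by
  have hK := two_le_card (Y := Y)
  have hW := totalWeight_pos h F
  have hW' := totalWeight_pos h (F ++ [(x, false, z)])
  have hl := labelWeight_nonneg h F x z
  have heq := totalWeight_append_false h F x z
  unfold potential
  set K : ℝ := (Fintype.card Y : ℝ)
  set W := totalWeight h F
  set W' := totalWeight h (F ++ [(x, false, z)])
  set l := labelWeight h F x z
  have hs : 0 < √K := Real.sqrt_pos.2 (by linarith)
  have hss : √K * √K = K := Real.mul_self_sqrt (by linarith)
  have hinv : K⁻¹ ≤ 1 / 2 := by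
    rw [inv_le_comm₀ (by linarith) (by norm_num)]; simpa using hK
  have hlog0 : 0 < Real.log K := Real.log_pos (by linarith)
  have hle : W' / W - 1 ≤ -(1 / (8 * √K)) := by
    have h1 : l / 2 ≤ l * (1 - K⁻¹) := by nlinarith
    have h2 : W / (8 * √K) ≤ l / 2 := by
      rw [div_le_iff₀ (by positivity)]; linarith
    rw [sub_le_iff_le_add, div_le_iff₀ hW]
    have h3 : W / (8 * √K) = 1 / (8 * √K) * W := by ring
    linarith
  have hlog : Real.log W' - Real.log W ≤ -(1 / (8 * √K)) := by
    rw [← Real.log_div hW'.ne' hW.ne']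
    exact (Real.log_le_sub_one_of_pos (by positivity)).trans hle
  -- Dividing by `log K ≤ 2 √K` turns the gain `1 / (8 √K)` into `1 / (16 K)`.
  have hgain : 1 / (16 * K) ≤ Real.logb K W - Real.logb K W' := by
    rw [Real.logb, Real.logb, ← sub_div, le_div_iff₀ hlog0]
    calc 1 / (16 * K) * Real.log K ≤ 1 / (16 * K) * (2 * √K) := by
          gcongr; exact log_le_two_mul_sqrt (by linarith)
      _ = 1 / (8 * √K) := by
          rw [div_mul_eq_mul_div, one_mul, div_eq_div_iff (by positivity) (by positivity)]
          linear_combination 16 * hss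
      _ ≤ _ := by linarith
  have := mul_le_mul_of_nonneg_left hgain (by positivity : (0 : ℝ) ≤ 16 * K)
  rw [mul_one_div_cancel (by positivity)] at this
  linarith

/-- A correct prediction of a label of small weight decreases the potential so much that it pays for
the mistakes of a uniformly random prediction. -/
lemma potential_append_true_add_card_le [Nonempty ι] (r : ℕ) (F : FeedbackSeq X Y) (x : X) (y : Y)
    (hy : 4 * √(Fintype.card Y) * labelWeight h F x y ≤ totalWeight h F) :
    potential h r (F ++ [(x, true, y)]) + Fintype.card Y ≤ potential h r F := by
  have hK := two_le_card (Y := Y)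
  have hW := totalWeight_pos h F
  have hW' := totalWeight_pos h (F ++ [(x, true, y)])
  have hl := labelWeight_nonneg h F x y
  have heq := totalWeight_append_true h F x y
  unfold potential
  set K : ℝ := (Fintype.card Y : ℝ)
  set W := totalWeight h F
  set W' := totalWeight h (F ++ [(x, true, y)])
  set l := labelWeight h F x y
  have hs : 0 < √K := Real.sqrt_pos.2 (by linarith)
  have hss : √K * √K = K := Real.mul_self_sqrt (by linarith)
  -- Hence `1 / (4 √K) + 1 / K ≤ 1 / √K`.
  have hs43 : 4 / 3 ≤ √K := Real.le_sqrt_of_sq_le (by linarith)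
  have hle : W' ≤ W / √K := by
    rw [le_div_iff₀ hs]
    have h1 : W' ≤ l + W * K⁻¹ := by
      have : 0 ≤ l * K⁻¹ := by positivity
      rw [heq]; linarith
    have h2 : K⁻¹ * √K ≤ 3 / 4 := by
      rw [inv_mul_le_iff₀ (by linarith)]
      nlinarith
    calc W' * √K ≤ (l + W * K⁻¹) * √K := by gcongr
      _ = l * √K + W * (K⁻¹ * √K) := by ring
      _ ≤ W / 4 + W * (3 / 4) := by gcongr; linarith
      _ = W := by ring
  have hlog : Real.logb K W' ≤ Real.logb K W - 1 / 2 := by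
    calc Real.logb K W' ≤ Real.logb K (W / √K) :=
          Real.logb_le_logb_of_le (by linarith) hW' hle
      _ = Real.logb K W - 1 / 2 := by
          rw [Real.logb_div hW.ne' hs.ne', Real.sqrt_eq_rpow,
            Real.logb_rpow (by linarith) (by linarith)]
  have := mul_le_mul_of_nonneg_left hlog (by positivity : (0 : ℝ) ≤ 16 * K)
  nlinarith

open Classical in
/-- The learner that predicts a label of weight at least `1 / (4 √|Y|)` of the total, if there is
one, and a uniformly random label otherwise. -/
noncomputable def weightLearner : Learner X Y := fun F x =>
  if hy : ∃ y, totalWeight h F ≤ 4 * √(Fintype.card Y) * labelWeight h F x y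
  then PMF.pure hy.choose else PMF.uniformOfFintype Y

lemma weightLearner_step [Nonempty ι] (r : ℕ) {F : FeedbackSeq X Y} {x : X} {y : Y}
    (hF : Realizable (budgetedPatterns (Set.range h) fun _ => r) (F ++ [(x, true, y)])) :
    ∑ z, weightLearner h F x z *
      (if z = y then ENNReal.ofReal (potential h r (F ++ [(x, true, z)]))
        else 1 + ENNReal.ofReal (potential h r (F ++ [(x, false, z)]))) ≤
      ENNReal.ofReal (potential h r F) := by
  classical
  unfold weightLearner
  split_ifs with hex
  · set a := hex.choose with ha
    have hspec : totalWeight h F ≤ 4 * √(Fintype.card Y) * labelWeight h F x a := hex.choose_spec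
    rw [Finset.sum_eq_single a (fun z _ hz => by simp [PMF.pure_apply, hz]) (by simp)]
    simp only [PMF.pure_apply, if_true, one_mul]
    split_ifs with hay
    · exact ENNReal.ofReal_le_ofReal (potential_append_true_le h r F x a)
    · rw [← ENNReal.ofReal_one, ← ENNReal.ofReal_add zero_le_one
        (potential_nonneg h (hF.append_false hay)), add_comm]
      exact ENNReal.ofReal_le_ofReal (potential_append_false_add_one_le h r F x a hspec)
  · push Not at hex
    have hK0 : (Fintype.card Y : ℝ≥0∞) ≠ 0 := by exact_mod_cast Fintype.card_ne_zero
    have hgain : ENNReal.ofReal (potential h r (F ++ [(x, true, y)])) + Fintype.card Y ≤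
        ENNReal.ofReal (potential h r F) := by
      rw [← ENNReal.ofReal_natCast, ← ENNReal.ofReal_add (potential_nonneg h hF) (by positivity)]
      exact ENNReal.ofReal_le_ofReal (potential_append_true_add_card_le h r F x y (hex y).le)
    set v := ENNReal.ofReal (potential h r F)
    set a := ENNReal.ofReal (potential h r (F ++ [(x, true, y)])) with ha
    simp only [PMF.uniformOfFintype_apply, ← Finset.mul_sum]
    rw [ENNReal.inv_mul_le_iff hK0 (ENNReal.natCast_ne_top _)]
    calc _ ≤ ∑ z, ((if z = y then a else v) + 1) := by
          refine Finset.sum_le_sum fun z _ => ?_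
          split_ifs with hzy
          · rw [hzy]; exact le_self_add
          · rw [add_comm]
            exact add_le_add_left
              (ENNReal.ofReal_le_ofReal (potential_append_false_le h r F x z)) _
      _ = ∑ z, ((if z = y then a else v) + (if z = y then (Fintype.card Y : ℝ≥0∞) else 0)) := by
          simp [Finset.sum_add_distrib]
      _ ≤ ∑ _z : Y, v := by
          refine Finset.sum_le_sum fun z _ => ?_
          split_ifs
          · exact hgain
          · simp
      _ = Fintype.card Y * v := by simp

lemma adapLossFrom_weightLearner_le [Nonempty ι] (r : ℕ) {A : Adversary X Y}
    (hA : A.Consistent (budgetedPatterns (Set.range h) fun _ => r)) (T : ℕ)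
    {F : FeedbackSeq X Y} (hF : Realizable (budgetedPatterns (Set.range h) fun _ => r) F) :
    adapLossFrom (weightLearner h) A T F ≤ ENNReal.ofReal (potential h r F) := by
  induction T generalizing F with
  | zero => simp [adapLossFrom]
  | succ T ih =>
    rw [adapLossFrom, Finset.sum_comm]
    set x := A.inst F with hx
    set π := weightLearner h F x with hπ
    set τ := A.label F x π with hτ
    refine le_of_le_of_eq ?_ (sum_pmf_mul_const τ _)
    refine Finset.sum_le_sum fun y _ => ?_
    by_cases hy : τ y = 0
    · simp [hy]
    have hreal := hA F hF π y ((PMF.mem_support_iff _ _).2 hy)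
    rw [← hx] at hreal
    refine le_trans ?_ (mul_le_mul_right (weightLearner_step h r hreal) _)
    rw [Finset.mul_sum]
    refine Finset.sum_le_sum fun z _ => ?_
    rw [mul_comm (π z), mul_assoc]
    refine mul_le_mul_right (mul_le_mul_right ?_ _) _
    split_ifs with hzy
    · exact ih (hzy ▸ hreal)
    · exact add_le_add_right (ih (hreal.append_false hzy)) _

theorem optAdap_le [Nonempty ι] (r : ℕ) :
    optAdap (budgetedPatterns (Set.range h) fun _ => r) ≤ ENNReal.ofReal
      (16 * (Fintype.card Y * (Real.logb (Fintype.card Y) (Fintype.card ι) + r))) := by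
  refine (iInf_le _ (weightLearner h)).trans (iSup₂_le fun A hA => iSup_le fun T => ?_)
  have hnil : Realizable (budgetedPatterns (Set.range h) fun _ => r) [] :=
    realizable_budgetedPatterns_iff.2
      ⟨_, ⟨Classical.arbitrary ι, rfl⟩, by simp⟩
  refine (adapLossFrom_weightLearner_le h r hA T hnil).trans (le_of_eq ?_)
  simp [potential, totalWeight, weight]

end UpperBound

/-! ### Prediction with expert advice -/

section Experts

lemma optExpertsObl_le_optExpertsAdap {n k : ℕ} (hk : 2 ≤ k) (r : ℕ) :
    optExpertsObl n k r ≤ optExpertsAdap n k r := by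
  have : Nontrivial (Fin k) := Fin.nontrivial_iff_two_le.2 hk
  exact optObl_le_optAdap _ _

lemma optExpertsAdap_le {n k : ℕ} (hk : 2 ≤ k) (hn : k ≤ n) (r : ℕ) :
    optExpertsAdap n k r ≤ ENNReal.ofReal (16 * (k * (Real.logb k n + r))) := by
  have : Nontrivial (Fin k) := Fin.nontrivial_iff_two_le.2 hk
  have : Nonempty (Fin n) := ⟨⟨0, by omega⟩⟩
  have h := optAdap_le (fun (i : Fin n) (x : Fin n → Fin k) => x i) r
  simp only [Fintype.card_fin] at h
  exact h

lemma mul_le_two_mul_optExpertsAdap {n k : ℕ} (hk : 2 ≤ k) (hn : k ≤ n) (r : ℕ) :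
    ((k * r : ℕ) : ℝ≥0∞) ≤ 2 * optExpertsAdap n k r := by
  have : Nontrivial (Fin k) := Fin.nontrivial_iff_two_le.2 hk
  have h := card_mul_le_two_mul_optAdap (H := experts n k)
    (x₀ := fun i => ⟨i % k, Nat.mod_lt _ (by omega)⟩)
    (fun y => ⟨_, ⟨Fin.castLE hn y, rfl⟩, by ext; simp [Nat.mod_eq_of_lt y.2]⟩) r
  rwa [Fintype.card_fin] at h

lemma le_optExpertsAdap {n k : ℕ} (hk : 2 ≤ k) (hn : k ≤ n) (r : ℕ) :
    ENNReal.ofReal (1 / 16 * (k * (Real.logb k n + r))) ≤ optExpertsAdap n k r := by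
  have h1 := (le_optExpertsObl hk hn r).trans (optExpertsObl_le_optExpertsAdap hk r)
  have h2 : ENNReal.ofReal (1 / 2 * (k * r)) ≤ optExpertsAdap n k r := by
    rw [one_div, ENNReal.ofReal_mul (by norm_num), ENNReal.ofReal_inv_of_pos two_pos,
      ENNReal.ofReal_ofNat, ← Nat.cast_mul, ENNReal.ofReal_natCast,
      ENNReal.inv_mul_le_iff two_ne_zero ENNReal.ofNat_ne_top]
    exact mul_le_two_mul_optExpertsAdap hk hn r
  -- The average of two lower bounds is at most the larger one.
  refine le_trans ?_ (max_le h1 h2)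
  rw [← ENNReal.ofReal_max]
  refine ENNReal.ofReal_le_ofReal ?_
  have h3 := le_max_left (1 / 8 * (k * Real.logb k n)) (1 / 2 * (k * r : ℝ))
  have h4 := le_max_right (1 / 8 * (k * Real.logb k n)) (1 / 2 * (k * r : ℝ))
  have : (0 : ℝ) ≤ k * r := by positivity
  linarith

end Experts
end BanditExperts

theorem mainTheorem3 :
    (∃ c₁ c₂ : ℝ, 0 < c₁ ∧ 0 < c₂ ∧
      ∀ n k r : ℕ, 2 ≤ k → k ≤ n →
        ENNReal.ofReal (c₁ * (k * (Real.logb k n + r))) ≤ BanditExperts.optExpertsAdap n k r ∧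
        BanditExperts.optExpertsAdap n k r ≤ ENNReal.ofReal (c₂ * (k * (Real.logb k n + r)))) ∧
    (∀ C : ℝ, ∃ c₁ c₂ : ℝ, 0 < c₁ ∧ 0 < c₂ ∧
      ∀ n k r : ℕ, 2 ≤ k → k ≤ n → (r : ℝ) ≤ C * Real.logb k n →
        ENNReal.ofReal (c₁ * (k * Real.logb k n)) ≤ BanditExperts.optExpertsObl n k r ∧
        BanditExperts.optExpertsObl n k r ≤ ENNReal.ofReal (c₂ * (k * Real.logb k n))) := by
  refine ⟨⟨1 / 16, 16, by norm_num, by norm_num, fun n k r hk hn =>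
    ⟨BanditExperts.le_optExpertsAdap hk hn r, BanditExperts.optExpertsAdap_le hk hn r⟩⟩,
    fun C => ⟨1 / 8, 16 * (1 + |C|), by norm_num, by positivity, fun n k r hk hn hr =>
      ⟨BanditExperts.le_optExpertsObl hk hn r,
        (BanditExperts.optExpertsObl_le_optExpertsAdap hk r).trans
          ((BanditExperts.optExpertsAdap_le hk hn r).trans (ENNReal.ofReal_le_ofReal ?_))⟩⟩⟩
  have hlog : 0 ≤ Real.logb k n :=
    Real.logb_nonneg (by exact_mod_cast hk) (by exact_mod_cast (by omega : 1 ≤ n))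
  have hr' : (r : ℝ) ≤ |C| * Real.logb k n :=
    hr.trans (mul_le_mul_of_nonneg_right (le_abs_self C) hlog)
  calc 16 * (k * (Real.logb k n + r)) ≤ 16 * (k * (Real.logb k n + |C| * Real.logb k n)) := by
        gcongr
    _ = 16 * (1 + |C|) * (k * Real.logb k n) := by ring
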